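/- Let $B=(G,\sigma)$ be a finite bidirected graph, that is, a finite loopless multigraph $G$ together with a map $\sigma$ that assigns a sign $\sigma(e,u)\in\{+,-\}$ to every edge $e$ and endpoint $u$ of $e$. A \emph{trail} in $B$ is a sequence $v_0\vec e_1v_1\dots \vec e_\ell v_\ell$ ($\ell\ge 0$) in which $\vec e_i$ is an orientation, from $v_{i-1}$ to $v_i$, of an edge $e_i$ of $G$ for $1\le i\le \ell$, the edges $e_1,\dots,e_\ell$ are pairwise distinct, and $\sigma(e_{i+1},v_i)=-\sigma(e_i,v_i)$ for $1\le i<\ell$; it is \emph{trivial} if $\ell=0$, and it is a \emph{path} if it does not repeat vertices. For sets $X,Y\subseteq V(B)$, an \emph{$X$--$Y$ path} is a path whose first vertex is its unique vertex in $X$ and whose last vertex is its unique vertex in $Y$. For $X, W\subseteq V(B)$ let $\epsilon_{X,B}(W)$ be the set of vertices $v\in W$ for which there is an $X$--$\{v\}$ path that is either trivial or whose second to last vertex is not in $W$. Let $X,Y\subseteq V(B)$ be such that there is no nontrivial path in $B$ with both endpoints in $X$. Then the maximum number of pairwise vertex-disjoint $X$--$Y$ paths in $B$ is equal to \[ \min\{\,|\epsilon_{X,B}(W)|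 : Y\subseteq W\subseteq V(B)\,\}. \] -/

import Mathlib

/-- A bidirected graph with vertex set `V` and edge set `E`: a loopless multigraph (parallel edges
are allowed) together with a signing of its half-edges, that is, of the pairs `(e, u)` where `u` is
an endpoint of the edge `e`. The signs `+` and `-` are the units `1` and `-1` of `ℤ`. -/
structure BidirectedGraph (V E : Type*) where
  ends : E → Sym2 V
  loopless : ∀ e, ¬ (ends e).IsDiag
  sign : {h : E × V // h.2 ∈ ends h.1} → ℤˣ

namespace BidirectedGraph

/-- An oriented edge: a triple `(e, u, v)` where `e` is an edge with endpoints `u` and `v`. -/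
structure OrientedEdge {V E : Type*} (B : BidirectedGraph V E) where
  edge : E
  tail : V
  head : V
  ends_eq : B.ends edge = s(tail, head)

/-- The sign of the underlying edge at the tail. -/
def OrientedEdge.tailSign {V E : Type*} {B : BidirectedGraph V E} (a : B.OrientedEdge) : ℤˣ :=
  B.sign ⟨(a.edge, a.tail), by simp [a.ends_eq]⟩

/-- The sign of the underlying edge at the head. -/
def OrientedEdge.headSign {V E : Type*} {B : BidirectedGraph V E} (a : B.OrientedEdge) : ℤˣ :=
  B.sign ⟨(a.edge, a.head), by simp [a.ends_eq]⟩

/-- A trail: an initial vertex followed by a list of oriented edges with pairwise distinct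
underlying edges, such that each oriented edge starts where the previous one ends and
the two edges have opposite signs at that vertex. -/
structure Trail {V E : Type*} (B : BidirectedGraph V E) where
  start : V
  steps : List B.OrientedEdge
  start_eq : ∀ a ∈ steps.head?, a.tail = start
  chain : steps.IsChain (fun a b => b.tail = a.head ∧ b.tailSign = - a.headSign)
  edges_nodup : (steps.map OrientedEdge.edge).Nodup

namespace Trail

/-- The sequence of vertices `v₀, v₁, …, v_ℓ` of a trail. -/
def vertices {V E : Type*} {B : BidirectedGraph V E} (T : B.Trail) : List V :=
  T.start :: T.steps.map OrientedEdge.head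

/-- The last vertex of a trail. -/
def finish {V E : Type*} {B : BidirectedGraph V E} (T : B.Trail) : V :=
  T.vertices.getLast (List.cons_ne_nil _ _)

/-- A trail is trivial if it consists of a single vertex. -/
def IsTrivial {V E : Type*} {B : BidirectedGraph V E} (T : B.Trail) : Prop :=
  T.steps = []

/-- A path is a trail that does not repeat vertices. -/
def IsPath {V E : Type*} {B : BidirectedGraph V E} (T : B.Trail) : Prop :=
  T.vertices.Nodup

/-- An `X`–`Y` path: a path whose first vertex is its unique vertex in `X` and whose last vertex
is its unique vertex in `Y`. -/
def IsSetPath {V E : Type*} {B : BidirectedGraph V E} (X Y : Set V) (T : B.Trail) : Prop :=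
  T.IsPath ∧
  (T.start ∈ X ∧ ∀ v ∈ T.vertices, v ∈ X → v = T.start) ∧
  (T.finish ∈ Y ∧ ∀ v ∈ T.vertices, v ∈ Y → v = T.finish)

/-- The trail is nontrivial and its second to last vertex, which is the tail of its last oriented
edge, does not lie in `W`. -/
def SecondToLastNotIn {V E : Type*} {B : BidirectedGraph V E} (T : B.Trail) (W : Set V) : Prop :=
  ∃ a ∈ T.steps.getLast?, a.tail ∉ W

end Trail

/-- The set of vertices `v ∈ W` for which there is an `X`–`{v}` path that is either trivial or
whose second to last vertex is not in `W`. -/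
def entrance {V E : Type*} (B : BidirectedGraph V E) (X W : Set V) : Set V :=
  {v | v ∈ W ∧ ∃ P : B.Trail, P.IsSetPath X {v} ∧ (P.IsTrivial ∨ P.SecondToLastNotIn W)}

/-- A family of pairwise vertex-disjoint `X`–`Y` paths. -/
def IsDisjointPathFamily {V E : Type*} (B : BidirectedGraph V E) (X Y : Set V)
    (F : Finset B.Trail) : Prop :=
  (∀ P ∈ F, P.IsSetPath X Y) ∧
  ∀ P ∈ F, ∀ Q ∈ F, P ≠ Q → P.vertices.Disjoint Q.vertices

end BidirectedGraph

/-! The upper bound holds because every `X`–`Y` path meets the entrance of each `W ⊇ Y`, so disjoint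
paths use distinct entrance vertices.

For the converse, blossoms are contracted, as in Edmonds' matching algorithm, until the bidirected
graph behaves like a digraph. A blossom forest grown from `X` records in which states (vertex and
departure sign) its vertices can be left: a base outside `X` with one sign only, every other vertex
with both. A forest of maximal size is closed (`exists_isClosed`): an edge leading out of it would
add a vertex, and an edge joining departure states of two blossoms would, after tracing both ends
back through parents, either close up to a larger blossom or give a nontrivial path between two
vertices of `X`, which is excluded.

In a closed forest a path from `X` enters every blossom through its base (`IsClosed.dep_finish`), so
it follows the digraph `Arc` on bases. If the blossoms with base in `A` miss `Y`, then the vertices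
outside them form a set `W ⊇ Y` whose entrance lies among the sources outside `A` and the heads of
arcs leaving `A` (`IsClosed.entrance_subset`). The assumed bound on entrances is thus the cut
condition for this digraph. Menger's theorem for digraphs (`exists_linkage`) gives disjoint paths of
bases, which lift to disjoint paths because blossoms are disjoint. -/

/-! ### Menger's theorem for digraphs, from Hall's theorem -/

/-- A Hall-type form of Menger's theorem for a relation on a finite type: if every set `A` avoiding
the targets `T` has at least `m` exits (counting the sources outside `A`), then at least `m` sources
lie on pairwise disjoint orbits of a map `g` that follow the relation and end in `T`. -/
theorem exists_linkage {V : Type*} [Finite V] (R : V → V → Prop) (X T : Set V)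
    (hR : ∀ u v, R u v → v ∉ X) (m : ℕ)
    (hm : ∀ A : Set V, Disjoint A T → m ≤ (X \ A ∪ {v | v ∉ A ∧ ∃ u ∈ A, R u v}).ncard) :
    ∃ X' ⊆ X, m ≤ X'.ncard ∧ ∃ (g : V → V) (n : V → ℕ),
      (∀ x ∈ X', g^[n x] x ∈ T) ∧
      (∀ x ∈ X', ∀ i < n x, R (g^[i] x) (g^[i + 1] x)) ∧
      ∀ x ∈ X', ∀ x' ∈ X', ∀ i ≤ n x, ∀ j ≤ n x', g^[i] x = g^[j] x' → x = x' ∧ i = j := by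
  classical
  have := Fintype.ofFinite V
  have hmX : m ≤ X.ncard := by simpa using hm ∅ (by simp)
  obtain ⟨d, hd⟩ := Nat.exists_eq_add_of_le hmX
  -- Each non-target must choose its own value: a successor, itself (idle) if it is not a source, or
  -- one of `d = |X| - m` dummies if it is a source. The dummies allow at most `d` sources to be
  -- given up.
  let t : {u // u ∉ T} → Finset (V ⊕ Fin d) := fun u => Finset.univ.filter fun z =>
    (∃ v, z = Sum.inl v ∧ (R u v ∨ (v = u ∧ u.1 ∉ X))) ∨ (u.1 ∈ X ∧ ∃ i, z = Sum.inr i)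
  obtain ⟨f, hfinj, hft⟩ :=
    (Finset.all_card_le_biUnion_card_iff_exists_injective t).1 (by
      intro s
      by_cases hsX : ∀ u ∈ s, u.1 ∉ X
      · refine Finset.card_le_card_of_injOn (fun u => Sum.inl u.1) ?_ ?_
        · intro u hu
          simp only [Finset.coe_biUnion, Set.mem_iUnion, t]
          exact ⟨u, hu, by simp [hsX u hu]⟩
        · intro u _ v _ h
          exact Subtype.ext (Sum.inl_injective h)
      · push Not at hsX
        obtain ⟨u₀, hu₀, hu₀X⟩ := hsX
        -- Once `s` contains a source, its neighbourhood contains all dummies, `A \ X` by idling,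
        -- and `N`. The cut condition for `A` gives `|N| ≥ m - |X \ A|`, which makes this at least
        -- `|A|`.
        let A : Set V := {v | ∃ h : v ∉ T, (⟨v, h⟩ : {u // u ∉ T}) ∈ s}
        have hA : A.ncard = s.card := by
          rw [← Set.ncard_coe_finset s, ← Set.ncard_image_of_injective _ Subtype.val_injective]
          congr 1
          ext v
          simp [A]
        let N : Set V := {v | v ∉ A ∧ ∃ u ∈ A, R u v}
        have h1 : m ≤ (X \ A ∪ N).ncard := hm A (Set.disjoint_left.2 fun v hv => hv.1)
        have h2 : (X \ A ∪ N).ncard ≤ (X \ A).ncard + N.ncard := Set.ncard_union_le _ _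
        have h3 : (X \ A).ncard + (X ∩ A).ncard = X.ncard := by
          rw [add_comm]; exact Set.ncard_inter_add_ncard_sdiff_eq_ncard X A
        have h4 : (A ∩ X).ncard + (A \ X).ncard = A.ncard :=
          Set.ncard_inter_add_ncard_sdiff_eq_ncard A X
        rw [Set.inter_comm] at h4
        have h5 : (A \ X ∪ N).ncard = (A \ X).ncard + N.ncard :=
          Set.ncard_union_eq (Set.disjoint_left.2 fun v hv hv' => hv'.1 hv.1)
        have h6 : (Sum.inl '' (A \ X ∪ N) ∪ Set.range (Sum.inr : Fin d → V ⊕ Fin d)).ncard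
            = (A \ X ∪ N).ncard + d := by
          rw [Set.ncard_union_eq, Set.ncard_image_of_injective _ Sum.inl_injective,
            Set.ncard_range_of_injective Sum.inr_injective]
          · simp
          · rw [Set.disjoint_left]
            rintro _ ⟨v, -, rfl⟩ ⟨i, hi⟩
            cases hi
        have h7 : Sum.inl '' (A \ X ∪ N) ∪ Set.range (Sum.inr : Fin d → V ⊕ Fin d)
            ⊆ (s.biUnion t : Finset (V ⊕ Fin d)) := by
          rintro z (⟨v, ⟨⟨hvT, hvs⟩, hvX⟩ | ⟨-, u, ⟨huT, hus⟩, huv⟩, rfl⟩ | ⟨i, rfl⟩)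
          · simp only [Finset.coe_biUnion, Set.mem_iUnion, t]
            exact ⟨_, hvs, by simp [hvX]⟩
          · simp only [Finset.coe_biUnion, Set.mem_iUnion, t]
            exact ⟨_, hus, by simp [huv]⟩
          · simp only [Finset.coe_biUnion, Set.mem_iUnion, t]
            exact ⟨_, hu₀, by simp [hu₀X]⟩
        have h8 := Set.ncard_le_ncard h7
        rw [Set.ncard_coe_finset] at h8
        omega)
  -- Fixing targets and vertices matched to dummies is a default: an orbit from `X'` is followed
  -- only until it reaches `T`, and before that it never meets a dummy.
  let g : V → V := fun u => if h : u ∉ T then (f ⟨u, h⟩).elim id (fun _ => u) else u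
  let X' : Set V := {x | x ∈ X ∧ ∀ h : x ∉ T, ∃ v, f ⟨x, h⟩ = Sum.inl v}
  have hgood : ∀ u (h : u ∉ T), (u ∉ X ∨ u ∈ X') →
      f ⟨u, h⟩ = Sum.inl (g u) ∧ (R u (g u) ∨ (g u = u ∧ u ∉ X)) := by
    intro u h hu
    have hmem := hft ⟨u, h⟩
    simp only [t, Finset.mem_filter, Finset.mem_univ, true_and] at hmem
    rcases hmem with ⟨v, hv, hv'⟩ | ⟨hX, i, hi⟩
    · have : g u = v := by simp [g, h, hv]
      rw [this]
      exact ⟨hv, hv'⟩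
    · rcases hu with hu | hu
      · exact absurd hX hu
      · obtain ⟨v, hv⟩ := hu.2 h
        simp [hi] at hv
  have hgX : ∀ u, u ∉ T → (u ∉ X ∨ u ∈ X') → g u ∉ X := by
    intro u h hu
    rcases (hgood u h hu).2 with h' | ⟨h', h''⟩
    · exact hR _ _ h'
    · rwa [h']
  have hiter : ∀ x ∈ X', ∀ i, (∀ k < i, g^[k] x ∉ T) → (g^[i] x ∉ X ∨ g^[i] x ∈ X') := by
    intro x hx i
    induction i with
    | zero => intro _; exact Or.inr hx
    | succ i ih =>
      intro h
      rw [Function.iterate_succ_apply']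
      exact Or.inl (hgX _ (h i (by omega)) (ih fun k hk => h k (by omega)))
  -- Injectivity of `f` cancels steps backwards until one orbit is at its source, which has no
  -- predecessor because values of `g` avoid `X`.
  have hinj : ∀ x ∈ X', ∀ x' ∈ X', ∀ i j, (∀ k < i, g^[k] x ∉ T) → (∀ k < j, g^[k] x' ∉ T) →
      g^[i] x = g^[j] x' → x = x' ∧ i = j := by
    intro x hx x' hx' i
    induction i with
    | zero =>
      rintro (_ | j) - hj h
      · exact ⟨h, rfl⟩
      · rw [Function.iterate_succ_apply'] at h
        refine absurd ?_ (hgX _ (hj j (by omega)) (hiter x' hx' j fun k hk => hj k (by omega)))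
        rw [← h]
        exact hx.1
    | succ i ih =>
      rintro (_ | j) hi hj h
      · rw [Function.iterate_succ_apply'] at h
        refine absurd ?_ (hgX _ (hi i (by omega)) (hiter x hx i fun k hk => hi k (by omega)))
        rw [h]
        exact hx'.1
      · rw [Function.iterate_succ_apply', Function.iterate_succ_apply'] at h
        have a := (hgood _ (hi i (by omega)) (hiter x hx i fun k hk => hi k (by omega))).1
        have b := (hgood _ (hj j (by omega)) (hiter x' hx' j fun k hk => hj k (by omega))).1
        rw [h, ← b] at a
        have := ih j (fun k hk => hi k (by omega)) (fun k hk => hj k (by omega))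
          (congrArg Subtype.val (hfinj a))
        exact ⟨this.1, by omega⟩
  have hex : ∀ x, ∃ n, x ∈ X' → g^[n] x ∈ T ∧ ∀ k < n, g^[k] x ∉ T := by
    intro x
    by_cases hx : x ∈ X'
    · by_cases h : ∃ n, g^[n] x ∈ T
      · exact ⟨Nat.find h, fun _ => ⟨Nat.find_spec h, fun k hk => Nat.find_min h hk⟩⟩
      · push Not at h
        exact absurd (Finite.of_injective (fun n : ℕ => g^[n] x) fun i j hij =>
          (hinj x hx x hx i j (fun k _ => h k) (fun k _ => h k) hij).2)
          (not_finite_iff_infinite.2 inferInstance)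
    · exact ⟨0, fun h => absurd h hx⟩
  choose n hn using hex
  refine ⟨X', fun x hx => hx.1, ?_, g, n, fun x hx => (hn x hx).1, ?_, ?_⟩
  · have hc : (X \ X').ncard ≤ d := by
      have : ∀ x, ∃ i : V ⊕ Fin d, x ∈ X \ X' → ∃ h : x ∉ T, f ⟨x, h⟩ = i ∧ ∃ k, i = Sum.inr k := by
        intro x
        by_cases hx : x ∈ X \ X'
        · have hx' := hx.2
          simp only [X', Set.mem_ofPred_eq, not_and, not_forall] at hx'
          obtain ⟨h, h'⟩ := hx' hx.1
          refine ⟨f ⟨x, h⟩, fun _ => ⟨h, rfl, ?_⟩⟩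
          rcases hfx : f ⟨x, h⟩ with v | k
          · exact absurd ⟨v, hfx⟩ h'
          · exact ⟨k, rfl⟩
        · exact ⟨Sum.inl x, fun h => absurd h hx⟩
      choose F hF using this
      have h9 : (X \ X').ncard ≤ (Set.range (Sum.inr : Fin d → V ⊕ Fin d)).ncard := by
        refine Set.ncard_le_ncard_of_injOn F ?_ ?_
        · intro x hx
          obtain ⟨_, _, k, hk⟩ := hF x hx
          exact ⟨k, hk.symm⟩
        · intro x hx y hy hxy
          obtain ⟨h, h', _⟩ := hF x hx
          obtain ⟨k, k', _⟩ := hF y hy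
          rw [← hxy, ← h'] at k'
          exact (congrArg Subtype.val (hfinj k')).symm
      rw [Set.ncard_range_of_injective Sum.inr_injective] at h9
      simpa using h9
    have h10 : (X ∩ X').ncard + (X \ X').ncard = X.ncard :=
      Set.ncard_inter_add_ncard_sdiff_eq_ncard X X'
    have h11 : (X ∩ X').ncard ≤ X'.ncard := Set.ncard_le_ncard Set.inter_subset_right
    omega
  · intro x hx i hi
    have hlt := (hn x hx).2
    have hg := (hgood (g^[i] x) (hlt i hi) (hiter x hx i fun k hk => hlt k (by omega))).2
    rw [← Function.iterate_succ_apply' g i x] at hg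
    rcases hg with hg | ⟨hg, -⟩
    · exact hg
    · have := (hinj x hx x hx (i + 1) i (fun k hk => hlt k (by omega))
        (fun k hk => hlt k (by omega)) hg).2
      omega
  · intro x hx x' hx' i hi j hj h
    exact hinj x hx x' hx' i j (fun k hk => (hn x hx).2 k (by omega))
      (fun k hk => (hn x' hx').2 k (by omega)) h

/-! ### States, connections between them, and the paths they contain -/

namespace BidirectedGraph

variable {V E : Type*} {B : BidirectedGraph V E}

/-- The same edge with the opposite orientation. -/
def OrientedEdge.reverse (a : B.OrientedEdge) : B.OrientedEdge :=
  ⟨a.edge, a.head, a.tail, by rw [a.ends_eq, Sym2.eq_swap]⟩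

/-- A state is a vertex with a sign, the sign of an edge along which we may leave the vertex. -/
def flipState (p : V × ℤˣ) : V × ℤˣ := (p.1, -p.2)

@[simp] theorem flipState_fst (p : V × ℤˣ) : (flipState p).1 = p.1 := rfl

@[simp] theorem flipState_flipState (p : V × ℤˣ) : flipState (flipState p) = p := by
  simp [flipState]

/-- There is an edge along which one may leave in state `p` and then be in state `q`. -/
def Step (B : BidirectedGraph V E) (p q : V × ℤˣ) : Prop :=
  ∃ a : B.OrientedEdge, a.tail = p.1 ∧ a.tailSign = p.2 ∧ a.head = q.1 ∧ a.headSign = -q.2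

theorem Step.flip {p q : V × ℤˣ} (h : B.Step p q) : B.Step (flipState q) (flipState p) := by
  obtain ⟨a, h1, h2, h3, h4⟩ := h
  refine ⟨a.reverse, h3, h4, h1, ?_⟩
  simp only [flipState, neg_neg]
  exact h2

/-- `B.Conn A p q`: there is a path from state `p` to state `q` with all vertices in `A`. -/
inductive Conn (B : BidirectedGraph V E) : Set V → V × ℤˣ → V × ℤˣ → Prop
  | refl {A p} : p.1 ∈ A → Conn B A p p
  | cons {A A' p q r} : p.1 ∈ A' → p.1 ∉ A → A ⊆ A' → B.Step p q → Conn B A q r → Conn B A' p r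

theorem Conn.mono {A A' : Set V} {p q : V × ℤˣ} (h : B.Conn A p q) (hA : A ⊆ A') :
    B.Conn A' p q := by
  cases h with
  | refl h => exact .refl (hA h)
  | cons h1 h2 h3 h4 h5 => exact .cons (hA h1) h2 (h3.trans hA) h4 h5

/-- Disjointness keeps the concatenation a path: `Conn.cons` requires each vertex to lie outside the
set allowed for the remainder. -/
theorem Conn.trans {A C : Set V} {p q r w : V × ℤˣ} (h : B.Conn A p q) (hs : B.Step q r)
    (h' : B.Conn C r w) (hd : Disjoint A C) : B.Conn (A ∪ C) p w := by
  induction h with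
  | refl h => exact .cons (Or.inl h) (Set.disjoint_left.1 hd h) Set.subset_union_right hs h'
  | cons h1 h2 h3 h4 h5 ih =>
    refine .cons (Or.inl h1) ?_ (Set.union_subset_union_left C h3) h4 (ih hs (hd.mono_left h3))
    rintro (h | h)
    · exact h2 h
    · exact Set.disjoint_left.1 hd h1 h

theorem Conn.flip {A : Set V} {p q : V × ℤˣ} (h : B.Conn A p q) :
    B.Conn A (flipState q) (flipState p) := by
  induction h with
  | refl h => exact .refl h
  | @cons A A' p q r h1 h2 h3 h4 h5 ih =>
    refine (ih.trans h4.flip (.refl (A := {p.1}) rfl) (by simpa using h2)).mono ?_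
    rintro v (h | rfl)
    · exact h3 h
    · exact h1

/-- Either a single step, or a path from `p` to `q` with interior vertices in `A`. -/
def Link (B : BidirectedGraph V E) (A : Set V) (p q : V × ℤˣ) : Prop :=
  B.Step p q ∨ ∃ r w, B.Step p r ∧ B.Conn A r w ∧ B.Step w q

theorem Link.flip {A : Set V} {p q : V × ℤˣ} (h : B.Link A p q) :
    B.Link A (flipState q) (flipState p) := by
  rcases h with h | ⟨r, w, h1, h2, h3⟩
  · exact Or.inl h.flip
  · exact Or.inr ⟨_, _, h3.flip, h2.flip, h1.flip⟩

theorem Link.trans_conn {A C : Set V} {p q w : V × ℤˣ} (h : B.Link A p q)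
    (h' : B.Conn C q w) (hd : Disjoint A C) :
    ∃ r', B.Step p r' ∧ B.Conn (A ∪ C) r' w := by
  rcases h with h | ⟨r, s, h1, h2, h3⟩
  · exact ⟨q, h, h'.mono Set.subset_union_right⟩
  · exact ⟨r, h1, h2.trans h3 h' hd⟩

/-- A connection ending in `Y` contains a path whose only vertex in `Y` is its last one. -/
theorem Conn.exists_trail {A : Set V} {p q : V × ℤˣ} (h : B.Conn A p q) (Y : Set V)
    (hY : q.1 ∈ Y) :
    ∃ T : B.Trail, T.start = p.1 ∧ T.IsPath ∧ (∀ v ∈ T.vertices, v ∈ A) ∧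
      (∀ a ∈ T.steps, a.tail ∈ A) ∧ (∀ a ∈ T.steps.head?, a.tailSign = p.2) ∧
      T.finish ∈ Y ∧ ∀ v ∈ T.vertices, v ∈ Y → v = T.finish := by
  have triv : ∀ (A : Set V) (p : V × ℤˣ), p.1 ∈ A → p.1 ∈ Y →
      ∃ T : B.Trail, T.start = p.1 ∧ T.IsPath ∧ (∀ v ∈ T.vertices, v ∈ A) ∧
      (∀ a ∈ T.steps, a.tail ∈ A) ∧ (∀ a ∈ T.steps.head?, a.tailSign = p.2) ∧
      T.finish ∈ Y ∧ ∀ v ∈ T.vertices, v ∈ Y → v = T.finish := by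
    intro A p hA hY
    exact ⟨⟨p.1, [], by simp, by simp, by simp⟩, rfl, by simp [Trail.IsPath, Trail.vertices],
      by simpa [Trail.vertices] using hA, by simp, by simp,
      by simpa [Trail.finish, Trail.vertices] using hY, by simp [Trail.finish, Trail.vertices]⟩
  induction h with
  | refl h => exact triv _ _ h hY
  | @cons A A' p q r h1 h2 h3 h4 h5 ih =>
    by_cases hpY : p.1 ∈ Y
    · exact triv _ _ h1 hpY
    · obtain ⟨T, t1, t2, t3, t4, t5, t6, t7⟩ := ih hY
      obtain ⟨a, a1, a2, a3, a4⟩ := h4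
      have hfin : ∀ (z : B.Trail), z.steps = a :: T.steps → z.finish = T.finish := by
        intro z hz
        simp [Trail.finish, Trail.vertices, hz, a3, t1]
      refine ⟨⟨p.1, a :: T.steps, by simp [a1], ?_, ?_⟩, rfl, ?_, ?_, ?_, ?_, ?_, ?_⟩
      · rw [List.isChain_cons]
        refine ⟨fun b hb => ⟨?_, ?_⟩, T.chain⟩
        · rw [T.start_eq b hb, t1, a3]
        · rw [t5 b hb, a4, neg_neg]
      · rw [List.map_cons, List.nodup_cons]
        refine ⟨?_, T.edges_nodup⟩
        rw [List.mem_map]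
        rintro ⟨b, hb, hba⟩
        -- A repeated edge would put `p.1` among the endpoints of a later edge, but these all lie in
        -- `A`, which omits `p.1`.
        have e : s(b.tail, b.head) = s(a.tail, a.head) := by rw [← a.ends_eq, ← b.ends_eq, hba]
        have hbh : b.head ∈ A := t3 _ (by simp only [Trail.vertices, List.mem_cons, List.mem_map];
                                          exact Or.inr ⟨b, hb, rfl⟩)
        have hbt := t4 b hb
        rcases Sym2.eq_iff.1 e with ⟨e1, _⟩ | ⟨_, e2⟩
        · exact h2 (by rwa [← a1, ← e1])
        · exact h2 (by rwa [← a1, ← e2])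
      · have : (p.1 :: T.vertices).Nodup := List.nodup_cons.2 ⟨fun h => h2 (t3 _ h), t2⟩
        simpa [Trail.IsPath, Trail.vertices, a3, t1] using this
      · intro v hv
        have hv' : v = p.1 ∨ v ∈ T.vertices := by
          simpa [Trail.vertices, a3, t1] using hv
        rcases hv' with rfl | hv'
        · exact h1
        · exact h3 (t3 v hv')
      · intro b hb
        rcases List.mem_cons.1 hb with rfl | hb
        · rwa [a1]
        · exact h3 (t4 b hb)
      · simpa using a2
      · rw [hfin _ rfl]; exact t6
      · intro v hv hvY
        have hv' : v = p.1 ∨ v ∈ T.vertices := by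
          simpa [Trail.vertices, a3, t1] using hv
        rw [hfin _ rfl]
        rcases hv' with rfl | hv'
        · exact absurd hvY hpY
        · exact t7 v hv' hvY

/-! ### Entrances meet all paths: the upper bound -/

/-- Removing the last edge of a trail. -/
theorem Trail.exists_init (T : B.Trail) {l : List B.OrientedEdge} {a : B.OrientedEdge}
    (h : T.steps = l ++ [a]) :
    ∃ T' : B.Trail, T'.steps = l ∧ T'.start = T.start ∧ T'.finish = a.tail ∧ T.finish = a.head ∧
      T.vertices = T'.vertices ++ [a.head] ∧ ∀ b ∈ l.getLast?, a.tailSign = -b.headSign := by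
  have hc := T.chain
  rw [h, List.isChain_append] at hc
  have hn := T.edges_nodup
  rw [h, List.map_append] at hn
  have hs := T.start_eq
  refine ⟨⟨T.start, l, ?_, hc.1, hn.of_append_left⟩, rfl, rfl, ?_, ?_, ?_, ?_⟩
  · intro b hb
    apply hs
    rw [h]
    cases l with
    | nil => simp at hb
    | cons c l => simpa using hb
  · rcases l.eq_nil_or_concat with rfl | ⟨l', c, rfl⟩
    · simpa [Trail.finish, Trail.vertices] using (hs a (by simp [h])).symm
    · have := (hc.2.2 c (by simp) a (by simp)).1
      simp [Trail.finish, Trail.vertices, this]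
  · simp [Trail.finish, Trail.vertices, h]
  · simp [Trail.vertices, h]
  · intro b hb
    exact (hc.2.2 b hb a (by simp)).2

/-- Every path from `X` to a vertex of `W` meets the entrance of `W`. -/
theorem Trail.exists_mem_entrance {X W : Set V} (T : B.Trail) (hT : T.IsPath)
    (hX : T.start ∈ X) (hX' : ∀ v ∈ T.vertices, v ∈ X → v = T.start) (hW : T.finish ∈ W) :
    ∃ v ∈ T.vertices, v ∈ B.entrance X W := by
  have hset : ∀ T : B.Trail, T.finish ∈ T.vertices := fun T => List.getLast_mem _
  generalize hl : T.steps.length = n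
  induction n generalizing T with
  | zero =>
    exact ⟨T.finish, hset T, hW, T, ⟨hT, ⟨hX, hX'⟩, rfl, fun v _ hv => hv⟩,
      Or.inl (List.length_eq_zero_iff.1 hl)⟩
  | succ n ih =>
    rcases T.steps.eq_nil_or_concat' with h0 | ⟨l, a, h⟩
    · simp [h0] at hl
    · obtain ⟨T', t1, t2, t3, t4, t5, -⟩ := T.exists_init h
      by_cases ha : a.tail ∈ W
      · obtain ⟨v, hv, hv'⟩ := ih T' (by rw [Trail.IsPath, t5] at hT; exact hT.of_append_left)
          (by rwa [t2]) (fun v hv => by rw [t2]; exact hX' v (by simp [t5, hv]))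
          (by rwa [t3]) (by simpa [h, t1] using hl)
        exact ⟨v, by simp [t5, hv], hv'⟩
      · exact ⟨T.finish, hset T, hW, T, ⟨hT, ⟨hX, hX'⟩, rfl, fun v _ hv => hv⟩,
          Or.inr ⟨a, by simp [h], ha⟩⟩

theorem IsDisjointPathFamily.card_le [Finite V] {X Y W : Set V} {F : Finset B.Trail}
    (hF : B.IsDisjointPathFamily X Y F) (hW : Y ⊆ W) : F.card ≤ (B.entrance X W).ncard := by
  have : ∀ P : B.Trail, ∃ v, P ∈ F → v ∈ P.vertices ∧ v ∈ B.entrance X W := by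
    intro P
    by_cases hP : P ∈ F
    · have h := hF.1 P hP
      obtain ⟨v, hv, hv'⟩ := P.exists_mem_entrance h.1 h.2.1.1 h.2.1.2 (hW h.2.2.1)
      exact ⟨v, fun _ => ⟨hv, hv'⟩⟩
    · exact ⟨P.start, fun h => absurd h hP⟩
  choose f hf using this
  rw [← Set.ncard_coe_finset]
  refine Set.ncard_le_ncard_of_injOn f (fun P hP => (hf P hP).2) ?_
  intro P hP Q hQ h
  by_contra hne
  exact hF.2 P hP Q hQ hne (hf P hP).1 (by rw [h]; exact (hf Q hQ).1)

end BidirectedGraph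

/-! ### Blossom forests and their enlargement -/

namespace BidirectedGraph

variable {V E : Type*} {B : BidirectedGraph V E}

/-- A blossom forest grown from the vertex set `X`. It partitions its vertex set `S` into blossoms,
each named by its base; `out b` is the sign with which paths starting in `X` leave the base `b`, and
every base outside `X` is entered from a blossom of smaller rank. Within a blossom, the base can be
connected to every departure state (see `dep`). -/
structure BlossomForest (B : BidirectedGraph V E) (X : Set V) where
  S : Set V
  base : V → V
  out : V → ℤˣ
  rank : V → ℕ
  /-- The states in which a path starting in `X` may leave a vertex of the forest. -/
  dep : V × ℤˣ → Prop
  dep_iff : ∀ p, dep p ↔ p.1 ∈ S ∧ (base p.1 = p.1 → p.1 ∈ X ∨ p.2 = out p.1)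
  base_eq_of_mem : ∀ x ∈ X, x ∈ S ∧ base x = x ∧ rank x = 0
  base_mem : ∀ v ∈ S, base v ∈ S
  base_base : ∀ v ∈ S, base (base v) = base v
  inside : ∀ p, dep p →
    ∃ s, dep (base p.1, s) ∧ B.Conn {v | v ∈ S ∧ base v = base p.1} (base p.1, s) p
  parent : ∀ b ∈ S, base b = b → b ∉ X →
    ∃ p, dep p ∧ B.Step p (b, out b) ∧ rank (base p.1) < rank b

namespace BlossomForest

variable {X : Set V}

/-- The forest in which every vertex of `X` is a blossom. -/
def trivial (B : BidirectedGraph V E) (X : Set V) : B.BlossomForest X where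
  S := X
  base := id
  out := 1
  rank := 0
  dep p := p.1 ∈ X
  dep_iff p := by simp +contextual
  base_eq_of_mem := by simp
  base_mem := by simp
  base_base := by simp
  inside p hp := ⟨p.2, hp, .refl ⟨hp, rfl⟩⟩
  parent := fun b h _ h' => absurd h h'

variable (F : B.BlossomForest X)

theorem dep_mem {F : B.BlossomForest X} {p : V × ℤˣ} (h : F.dep p) : p.1 ∈ F.S :=
  ((F.dep_iff p).1 h).1

/-- The size of a forest, which grows when a vertex is added and when blossoms are merged. -/
noncomputable def size : ℕ := F.S.ncard + {v | v ∈ F.S ∧ F.base v ≠ v}.ncard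

/-- The set of vertices of the blossoms with base in `J`. -/
def verts (J : Set V) : Set V := {v | v ∈ F.S ∧ F.base v ∈ J}

theorem disjoint_verts {J K : Set V} (h : Disjoint J K) : Disjoint (F.verts J) (F.verts K) :=
  Set.disjoint_left.2 fun _ hv hv' => Set.disjoint_left.1 h hv.2 hv'.2

theorem verts_mono {J K : Set V} (h : J ⊆ K) : F.verts J ⊆ F.verts K :=
  fun _ hv => ⟨hv.1, h hv.2⟩

theorem inside' {F : B.BlossomForest X} {p : V × ℤˣ} (h : F.dep p) :
    ∃ s, F.dep (F.base p.1, s) ∧ B.Conn (F.verts {F.base p.1}) (F.base p.1, s) p :=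
  F.inside p h

/-- The new vertex becomes a singleton blossom, left with the sign `q.2` and ranked one above the
blossom of its parent. -/
theorem exists_size_lt_of_notMem [Finite V] {p q : V × ℤˣ} (hp : F.dep p) (hs : B.Step p q)
    (hq : q.1 ∉ F.S) : ∃ F' : B.BlossomForest X, F.size < F'.size := by
  classical
  obtain ⟨w, t⟩ := q
  change w ∉ F.S at hq
  have hne : ∀ v ∈ F.S, v ≠ w := fun v hv h => hq (h ▸ hv)
  have hbne : ∀ v ∈ F.S, F.base v ≠ w := fun v hv h => hq (h ▸ F.base_mem v hv)
  have key : ∀ p, F.dep p → (p.1 ∈ insert w F.S ∧ (Function.update F.base w w p.1 = p.1 →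
      p.1 ∈ X ∨ p.2 = Function.update F.out w t p.1)) := by
    intro p hp
    have := hne _ (dep_mem hp)
    simpa [this] using (F.dep_iff p).1 hp
  refine ⟨⟨insert w F.S, Function.update F.base w w, Function.update F.out w t,
    Function.update F.rank w (F.rank (F.base p.1) + 1), _, fun _ => Iff.rfl, ?_, ?_, ?_, ?_, ?_⟩, ?_⟩
  · intro x hx
    obtain ⟨h1, h2, h3⟩ := F.base_eq_of_mem x hx
    simp [h1, h2, h3, hne x h1]
  · rintro v (rfl | hv)
    · simp
    · simp [hne v hv, F.base_mem v hv]
  · rintro v (rfl | hv)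
    · simp
    · simp [hne v hv, hbne v hv, F.base_base v hv]
  · rintro ⟨v, s⟩ ⟨hv, hvs⟩
    rcases hv with rfl | hv
    · refine ⟨s, ?_, ?_⟩
      · simpa using hvs
      · simp only [Function.update_self]
        exact .refl (by simp)
    · have hv : v ∈ F.S := hv
      have hd : F.dep (v, s) := (F.dep_iff _).2 ⟨hv, by simpa [hne v hv] using hvs⟩
      obtain ⟨s', h1, h2⟩ := F.inside _ hd
      refine ⟨s', ?_, ?_⟩
      · simpa [hne v hv] using key _ h1
      · simp only [Function.update_of_ne (hne v hv)]
        refine h2.mono ?_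
        rintro u ⟨hu, hu'⟩
        exact ⟨Or.inr hu, by simpa [hne u hu] using hu'⟩
  · rintro b (rfl | hb) hbb hbX
    · refine ⟨p, key p hp, by simpa using hs, ?_⟩
      simp [hne _ (dep_mem hp), hbne _ (dep_mem hp)]
    · obtain ⟨p', h1, h2, h3⟩ := F.parent b hb (by simpa [hne b hb] using hbb) hbX
      refine ⟨p', key p' h1, by simpa [hne b hb] using h2, ?_⟩
      simpa [hne _ (dep_mem h1), hbne _ (dep_mem h1), hne b hb] using h3
  · simp only [size]
    rw [Set.ncard_insert_of_notMem hq]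
    have : {v | v ∈ F.S ∧ F.base v ≠ v}.ncard ≤
        {v | v ∈ insert w F.S ∧ Function.update F.base w w v ≠ v}.ncard := by
      refine Set.ncard_le_ncard ?_
      rintro v ⟨hv, hv'⟩
      exact ⟨Or.inr hv, by simpa [hne v hv] using hv'⟩
    omega

/-- Merging the blossoms with base in `J` into the blossom of `p` and `q`. -/
theorem exists_size_lt_of_base_eq [Finite V] {p q : V × ℤˣ} (hp : F.dep p) (hq : F.dep q)
    (hpq : F.base p.1 = F.base q.1) (J : Set V) (hJne : J.Nonempty)
    (hJ : ∀ j ∈ J, j ∈ F.S ∧ F.base j = j ∧ j ∉ X ∧ F.rank (F.base p.1) ≤ F.rank j)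
    (hpJ : F.base p.1 ∉ J)
    (hcov : ∀ d, d.1 ∈ F.verts J → (∃ r, B.Step p r ∧ B.Conn (F.verts J) r d) ∨
      ∃ r, B.Step q r ∧ B.Conn (F.verts J) r d) :
    ∃ F' : B.BlossomForest X, F.size < F'.size := by
  classical
  set c := F.base p.1 with hc
  have hcS : c ∈ F.S := F.base_mem _ (dep_mem hp)
  have hcc : F.base c = c := F.base_base _ (dep_mem hp)
  let base' : V → V := fun v => if F.base v ∈ J then c else F.base v
  have hb1 : ∀ v, F.base v ∈ J → base' v = c := fun v h => if_pos h
  have hb2 : ∀ v, F.base v ∉ J → base' v = F.base v := fun v h => if_neg h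
  have hb'c : base' c = c := by rw [hb2 c (by rwa [hcc]), hcc]
  have hfix : ∀ v, base' v = v → F.base v ∉ J ∧ F.base v = v := by
    intro v hv
    by_cases h : F.base v ∈ J
    · rw [hb1 v h] at hv
      rw [← hv, hcc] at h
      exact absurd h hpJ
    · exact ⟨h, by rw [← hb2 v h, hv]⟩
  have key : ∀ p, F.dep p → (p.1 ∈ F.S ∧ (base' p.1 = p.1 → p.1 ∈ X ∨ p.2 = F.out p.1)) :=
    fun p hp => ⟨dep_mem hp, fun h => ((F.dep_iff p).1 hp).2 (hfix _ h).2⟩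
  have hdisj : Disjoint (F.verts {c}) (F.verts J) :=
    F.disjoint_verts (Set.disjoint_singleton_left.2 hpJ)
  have hsub : F.verts {c} ∪ F.verts J ⊆ {v | v ∈ F.S ∧ base' v = c} := by
    rintro v (⟨hv, hv'⟩ | ⟨hv, hv'⟩)
    · have hv' : F.base v = c := hv'
      exact ⟨hv, by rw [hb2 v (by rwa [hv']), hv']⟩
    · exact ⟨hv, hb1 v hv'⟩
  have hmerge : ∀ (p' d r : V × ℤˣ), F.dep p' → F.base p'.1 = c → B.Step p' r →
      B.Conn (F.verts J) r d → ∃ s, F.dep (c, s) ∧ B.Conn {v | v ∈ F.S ∧ base' v = c} (c, s) d := by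
    intro p' d r hp' hbp hs hr
    obtain ⟨s, h1, h2⟩ := inside' hp'
    rw [hbp] at h1 h2
    exact ⟨s, h1, (h2.trans hs hr hdisj).mono hsub⟩
  refine ⟨⟨F.S, base', F.out, F.rank, _, fun _ => Iff.rfl, ?_, ?_, ?_, ?_, ?_⟩, ?_⟩
  · intro x hx
    obtain ⟨h1, h2, h3⟩ := F.base_eq_of_mem x hx
    refine ⟨h1, ?_, h3⟩
    rw [hb2 x (fun h => (hJ _ h).2.2.1 (by rwa [h2])), h2]
  · intro v hv
    by_cases h : F.base v ∈ J
    · rwa [hb1 v h]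
    · rw [hb2 v h]; exact F.base_mem v hv
  · intro v hv
    by_cases h : F.base v ∈ J
    · rw [hb1 v h, hb'c]
    · rw [hb2 v h, hb2 _ (by rwa [F.base_base v hv]), F.base_base v hv]
  · rintro d ⟨hd, hd'⟩
    by_cases h : F.base d.1 ∈ J
    · rw [hb1 _ h]
      rcases hcov d ⟨hd, h⟩ with ⟨r, h1, h2⟩ | ⟨r, h1, h2⟩
      · obtain ⟨s, h3, h4⟩ := hmerge p d r hp rfl h1 h2
        exact ⟨s, key _ h3, h4⟩
      · obtain ⟨s, h3, h4⟩ := hmerge q d r hq hpq.symm h1 h2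
        exact ⟨s, key _ h3, h4⟩
    · have hdd : F.dep d := (F.dep_iff d).2 ⟨hd, fun h' => hd' (by rw [hb2 _ h, h'])⟩
      obtain ⟨s, h1, h2⟩ := F.inside d hdd
      rw [hb2 _ h]
      refine ⟨s, key _ h1, h2.mono ?_⟩
      rintro v ⟨hv, hv'⟩
      exact ⟨hv, by rw [hb2 v (by rwa [hv']), hv']⟩
  · intro b hb hbb hbX
    obtain ⟨p', h1, h2, h3⟩ := F.parent b hb (hfix b hbb).2 hbX
    -- Merging only replaces bases by one of no larger rank, so parents keep smaller rank.
    refine ⟨p', key p' h1, h2, lt_of_le_of_lt ?_ h3⟩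
    by_cases h : F.base p'.1 ∈ J
    · rw [hb1 _ h]; exact (hJ _ h).2.2.2
    · rw [hb2 _ h]
  · simp only [size]
    refine Nat.add_lt_add_left (Set.ncard_lt_ncard ?_) _
    rw [Set.ssubset_iff_of_subset]
    · obtain ⟨j, hj⟩ := hJne
      refine ⟨j, ⟨(hJ j hj).1, fun h => ?_⟩, fun h => h.2 (hJ j hj).2.1⟩
      exact (hfix j h).1 (by rwa [(hJ j hj).2.1])
    · rintro v ⟨hv, hv'⟩
      exact ⟨hv, fun h => hv' (hfix v h).2⟩

/-- If two departure states are linked through blossoms with base in `J`, all of whose states can be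
reached from them, then either the forest can be enlarged or there is a path between two vertices
of `X`. -/
theorem exists_size_lt_of_link [Finite V]
    (hX : ∀ A p q, B.Conn A p q → p.1 ∈ X → q.1 ∈ X → p.1 = q.1) (n : ℕ) :
    ∀ (p q : V × ℤˣ) (J : Set V), F.rank (F.base p.1) + F.rank (F.base q.1) = n →
      F.dep p → F.dep q → (J.Nonempty ∨ F.base p.1 ≠ F.base q.1) →
      (∀ j ∈ J, j ∈ F.S ∧ F.base j = j ∧ j ∉ X ∧ F.rank (F.base p.1) ≤ F.rank j ∧
        F.rank (F.base q.1) ≤ F.rank j) →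
      F.base p.1 ∉ J → F.base q.1 ∉ J → B.Link (F.verts J) p (flipState q) →
      (∀ d, d.1 ∈ F.verts J → (∃ r, B.Step p r ∧ B.Conn (F.verts J) r d) ∨
        ∃ r, B.Step q r ∧ B.Conn (F.verts J) r d) →
      ∃ F' : B.BlossomForest X, F.size < F'.size := by
  induction n using Nat.strong_induction_on with
  | _ n ih =>
    intro p q J hn hp hq hne hJ hpJ hqJ hL hcov
    -- Equal bases: the link closes up and its blossoms merge. Otherwise the end whose base has
    -- larger rank is moved to its parent, and that base joins `J`.
    by_cases hpq : F.base p.1 = F.base q.1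
    · exact F.exists_size_lt_of_base_eq hp hq hpq J (hne.resolve_right (not_not.2 hpq))
        (fun j hj => ⟨(hJ j hj).1, (hJ j hj).2.1, (hJ j hj).2.2.1, (hJ j hj).2.2.2.1⟩) hpJ hcov
    clear hne
    wlog hrank : F.rank (F.base q.1) ≤ F.rank (F.base p.1) generalizing p q
    · refine this q p (by omega) hq hp
        (fun j hj => ⟨(hJ j hj).1, (hJ j hj).2.1, (hJ j hj).2.2.1, (hJ j hj).2.2.2.2,
          (hJ j hj).2.2.2.1⟩) hqJ hpJ ?_ (fun d hd => (hcov d hd).symm) (Ne.symm hpq) (by omega)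
      simpa using hL.flip
    have hbS := F.base_mem _ (dep_mem hp)
    have hbb := F.base_base _ (dep_mem hp)
    obtain ⟨s, hs, hconn⟩ := inside' hp
    obtain ⟨s', hs', hconn'⟩ := inside' hq
    by_cases hbX : F.base p.1 ∈ X
    · exfalso
      -- A base in `X` has rank zero, so by `hrank` the other base has no room for a parent and also
      -- lies in `X`. The link then extends to a path between distinct vertices of `X`.
      have hqX : F.base q.1 ∈ X := by
        by_contra hqX
        obtain ⟨p', -, -, h⟩ := F.parent _ (F.base_mem _ (dep_mem hq))
          (F.base_base _ (dep_mem hq)) hqX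
        have := (F.base_eq_of_mem _ hbX).2.2
        omega
      have d1 : Disjoint (F.verts J) (F.verts {F.base q.1}) :=
        F.disjoint_verts (Set.disjoint_singleton_right.2 hqJ)
      have d2 : Disjoint (F.verts {F.base p.1}) (F.verts J ∪ F.verts {F.base q.1}) := by
        rw [Set.disjoint_union_right]
        exact ⟨F.disjoint_verts (Set.disjoint_singleton_left.2 hpJ),
          F.disjoint_verts (Set.disjoint_singleton.2 hpq)⟩
      obtain ⟨r, h1, h2⟩ := hL.trans_conn hconn'.flip d1
      exact hpq (hX _ _ _ (hconn.trans h1 h2 d2) hbX hqX)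
    · obtain ⟨p₀, hp₀, hstep, hlt⟩ := F.parent _ hbS hbb hbX
      have hsout : s = F.out (F.base p.1) := (((F.dep_iff _).1 hs).2 hbb).resolve_left hbX
      rw [hsout] at hs hconn
      set b := F.base p.1 with hb
      have hdisj : Disjoint (F.verts {b}) (F.verts J) :=
        F.disjoint_verts (Set.disjoint_singleton_left.2 hpJ)
      have hunion : F.verts {b} ∪ F.verts J ⊆ F.verts (insert b J) :=
        Set.union_subset (F.verts_mono (by simp)) (F.verts_mono (by simp))
      have hJb : ∀ j ∈ J, F.rank b ≤ F.rank j := fun j hj => (hJ j hj).2.2.2.1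
      refine ih _ ?_ p₀ q (insert b J) rfl hp₀ hq (Or.inl ⟨b, by simp⟩) ?_ ?_ ?_ ?_ ?_
      · omega
      · rintro j (rfl | hj)
        · exact ⟨hbS, hbb, hbX, hlt.le, hrank⟩
        · obtain ⟨h1, h2, h3, h4, h5⟩ := hJ j hj
          exact ⟨h1, h2, h3, by omega, h5⟩
      · rintro (h | h)
        · rw [h] at hlt; exact lt_irrefl _ hlt
        · have := hJb _ h; omega
      · rintro (h | h)
        · exact hpq h.symm
        · exact hqJ h
      · refine Or.inr ?_
        rcases hL with hL | ⟨r, w, h1, h2, h3⟩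
        · exact ⟨_, p, hstep, hconn.mono (Set.subset_union_left.trans hunion), hL⟩
        · exact ⟨_, w, hstep, (hconn.trans h1 h2 hdisj).mono hunion, h3⟩
      · rintro d ⟨hd, hdJ⟩
        by_cases hdb : F.base d.1 = b
        -- Departure states of the absorbed blossom are reached from `p₀` through its base. The only
        -- other state is the base with the opposite sign; it is reached from `q` by running the
        -- link and the path inside the blossom backwards.
        · by_cases hdd : F.dep d
          · obtain ⟨t, ht, hct⟩ := inside' hdd
            rw [hdb] at ht hct
            have : t = F.out b := (((F.dep_iff _).1 ht).2 hbb).resolve_left hbX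
            rw [this] at hct
            exact Or.inl ⟨_, hstep, hct.mono (Set.subset_union_left.trans hunion)⟩
          · rw [F.dep_iff] at hdd
            push Not at hdd
            obtain ⟨h1, h2, h3⟩ := hdd hd
            have hd1 : d.1 = b := by rw [← h1, hdb]
            have hflip : d = flipState (b, F.out b) := by
              refine Prod.ext hd1 ?_
              rw [hd1] at h3
              exact Int.units_ne_iff_eq_neg.1 h3
            have hL' := hL.flip
            rw [flipState_flipState] at hL'
            obtain ⟨r, h4, h5⟩ := hL'.trans_conn hconn.flip hdisj.symm
            rw [hflip]
            exact Or.inr ⟨r, h4, h5.mono (by rwa [Set.union_comm])⟩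
        · rcases hcov d ⟨hd, hdJ.resolve_left hdb⟩ with ⟨r, h1, h2⟩ | ⟨r, h1, h2⟩
          · exact Or.inl ⟨_, hstep, (hconn.trans h1 h2 hdisj).mono hunion⟩
          · exact Or.inr ⟨r, h1, h2.mono (Set.subset_union_right.trans hunion)⟩

/-! ### Closed forests -/

/-- A forest is closed if its departure states only lead into it, and edges between departure states
stay within a blossom. -/
def IsClosed : Prop :=
  ∀ p q, F.dep p → B.Step p q → q.1 ∈ F.S ∧ (F.dep (flipState q) → F.base p.1 = F.base q.1)

/-- The size is bounded by `2|V|`, so a forest of maximal size exists; a violation of closedness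
would enlarge it, with the offending edge as a link and `J = ∅` in the second case. -/
theorem exists_isClosed [Finite V]
    (hX : ∀ A p q, B.Conn A p q → p.1 ∈ X → q.1 ∈ X → p.1 = q.1) :
    ∃ F : B.BlossomForest X, F.IsClosed := by
  have hbound : ∀ F : B.BlossomForest X, F.size ≤ Nat.card V + Nat.card V := fun F => by
    have h1 := Set.ncard_le_card F.S
    have h2 := Set.ncard_le_card {v | v ∈ F.S ∧ F.base v ≠ v}
    simp only [size]
    omega
  have hfin : (Set.range (size : B.BlossomForest X → ℕ)).Finite :=
    (Set.finite_Iic (Nat.card V + Nat.card V)).subset (by rintro _ ⟨F, rfl⟩; exact hbound F)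
  obtain ⟨_, ⟨⟨F, rfl⟩, hmax⟩⟩ := hfin.exists_maximal ⟨_, trivial B X, rfl⟩
  have hnot : ¬ ∃ F' : B.BlossomForest X, F.size < F'.size := by
    rintro ⟨F', h⟩
    exact absurd (hmax ⟨F', rfl⟩ h.le) (by simpa using h)
  refine ⟨F, fun p q hp hs => ⟨?_, fun hq => ?_⟩⟩
  · by_contra hq
    exact hnot (F.exists_size_lt_of_notMem hp hs hq)
  · by_contra hne
    exact hnot (F.exists_size_lt_of_link hX _ p (flipState q) ∅ rfl hp hq (Or.inr hne)
      (by simp) (by simp) (by simp) (Or.inl (by simpa using hs)) (by simp [verts]))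

/-- Every step from a departure state of a closed forest that does not lead to a departure state
within its blossom enters a base outside `X`. -/
theorem IsClosed.step_cases {F : B.BlossomForest X} (hF : F.IsClosed) {p q : V × ℤˣ}
    (hp : F.dep p) (hs : B.Step p q) : F.base p.1 = F.base q.1 ∨
      (q.1 ∈ F.S ∧ F.base q.1 = q.1 ∧ q.1 ∉ X ∧ q.2 = F.out q.1) := by
  obtain ⟨h1, h2⟩ := hF p q hp hs
  by_cases hd : F.dep (flipState q)
  · exact Or.inl (h2 hd)
  · rw [F.dep_iff] at hd
    push Not at hd
    obtain ⟨h3, h4, h5⟩ := hd h1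
    refine Or.inr ⟨h1, h3, h4, ?_⟩
    have := Int.units_ne_iff_eq_neg.1 h5
    simpa [flipState] using this

end BlossomForest

end BidirectedGraph

/-! ### Reduction to the digraph of bases -/

namespace BidirectedGraph

variable {V E : Type*} {B : BidirectedGraph V E} {X : Set V}

theorem Conn.fst_eq_of_mem
    (hX : ¬ ∃ P : B.Trail, P.IsPath ∧ ¬ P.IsTrivial ∧ P.start ∈ X ∧ P.finish ∈ X)
    (A : Set V) (p q : V × ℤˣ) (h : B.Conn A p q) (hp : p.1 ∈ X) (hq : q.1 ∈ X) : p.1 = q.1 := by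
  obtain ⟨T, h1, h2, -, -, -, h3, -⟩ := h.exists_trail {q.1} rfl
  have h3 : T.finish = q.1 := h3
  by_contra hne
  refine hX ⟨T, h2, fun ht => hne ?_, by rwa [h1], by rwa [h3]⟩
  have ht : T.steps = [] := ht
  rw [← h1, ← h3]
  simp [Trail.finish, Trail.vertices, ht]

theorem OrientedEdge.step (a : B.OrientedEdge) :
    B.Step (a.tail, a.tailSign) (a.head, -a.headSign) :=
  ⟨a, rfl, rfl, rfl, (neg_neg _).symm⟩

namespace BlossomForest

/-- A path starting in `X` only visits departure states of a closed forest, and enters every blossom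
through its base. -/
theorem IsClosed.dep_finish {F : B.BlossomForest X} (hF : F.IsClosed) (T : B.Trail)
    (hT : T.IsPath) (hX : T.start ∈ X) (s : ℤˣ)
    (hs : ∀ a ∈ T.steps.getLast?, s = -a.headSign) :
    F.dep (T.finish, s) ∧ F.base T.finish ∈ T.vertices := by
  generalize hl : T.steps.length = n
  induction n generalizing T s with
  | zero =>
    have h0 := List.length_eq_zero_iff.1 hl
    have hfin : T.finish = T.start := by simp [Trail.finish, Trail.vertices, h0]
    obtain ⟨h1, h2, -⟩ := F.base_eq_of_mem _ hX
    rw [hfin, F.dep_iff, h2]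
    exact ⟨⟨h1, fun _ => Or.inl hX⟩, by simp [Trail.vertices]⟩
  | succ n ih =>
    rcases T.steps.eq_nil_or_concat' with h0 | ⟨l, a, h⟩
    · simp [h0] at hl
    · obtain ⟨T', t1, t2, t3, t4, t5, t6⟩ := T.exists_init h
      rw [Trail.IsPath, t5] at hT
      obtain ⟨hd, hb⟩ := ih T' hT.of_append_left (by rwa [t2]) a.tailSign (by rwa [t1])
        (by simpa [h, t1] using hl)
      have hsa : s = -a.headSign := hs a (by simp [h])
      rw [t3] at hd hb
      rw [t4, t5, hsa]
      have hnot : a.head ∉ T'.vertices := fun hmem => by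
        have := (List.nodup_append.1 hT).2.2 _ hmem a.head (by simp)
        exact this rfl
      have hS := (hF _ _ hd a.step).1
      -- If the last edge stays in a blossom, its base was already visited, so the new vertex is not
      -- a base and may be left with either sign. Otherwise the edge enters a base in its departure
      -- state.
      rcases hF.step_cases hd a.step with hc | ⟨-, hc, -, hc'⟩
      · have hc : F.base a.tail = F.base a.head := hc
        rw [hc] at hb
        refine ⟨(F.dep_iff _).2 ⟨hS, fun h' => ?_⟩, by simp [hb]⟩
        have h' : F.base a.head = a.head := h'
        rw [h'] at hb
        exact absurd hb hnot
      · exact ⟨(F.dep_iff _).2 ⟨hS, fun _ => Or.inr hc'⟩, by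
          have hc : F.base a.head = a.head := hc
          simp [hc]⟩

/-- The digraph on the bases of a forest: there is an arc from `b` to `v` if the base `v` can be
entered from a departure state in the blossom of `b`. -/
def Arc (F : B.BlossomForest X) (b v : V) : Prop :=
  v ∈ F.S ∧ F.base v = v ∧ v ∉ X ∧ ∃ p, F.dep p ∧ F.base p.1 = b ∧ B.Step p (v, F.out v)

/-- The set on the left belongs to the complement of the blossoms with base in `A`. A path whose
last edge enters this complement changes blossom there, so that edge enters a base and gives an arc
leaving `A`. -/
theorem IsClosed.entrance_subset {F : B.BlossomForest X} (hF : F.IsClosed) (A : Set V) :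
    B.entrance X {v | v ∈ F.S → F.base v ∉ A} ⊆
      X \ A ∪ {v | v ∉ A ∧ ∃ u ∈ A, F.Arc u v} := by
  rintro v ⟨hvW, P, ⟨hP, ⟨hPX, -⟩, hPv, -⟩, htriv | ⟨a, ha, haW⟩⟩
  · have hPv : P.finish = v := hPv
    have htriv : P.steps = [] := htriv
    have hv : P.start = v := by rw [← hPv]; simp [Trail.finish, Trail.vertices, htriv]
    rw [hv] at hPX
    obtain ⟨h1, h2, -⟩ := F.base_eq_of_mem _ hPX
    refine Or.inl ⟨hPX, fun hvA => hvW h1 (by rwa [h2])⟩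
  · rcases P.steps.eq_nil_or_concat' with h0 | ⟨l, a', h⟩
    · simp [h0] at ha
    · obtain rfl : a' = a := by simpa [h] using ha
      have hPv : P.finish = v := hPv
      obtain ⟨T', t1, t2, t3, t4, t5, t6⟩ := P.exists_init h
      rw [Trail.IsPath, t5] at hP
      obtain ⟨hd, -⟩ := hF.dep_finish T' hP.of_append_left (by rwa [t2]) a'.tailSign (by rwa [t1])
      rw [t3] at hd
      obtain rfl : a'.head = v := by rw [← t4, hPv]
      have haA : F.base a'.tail ∈ A := by
        by_contra h
        exact haW fun _ => h
      have hS := (hF _ _ hd a'.step).1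
      rcases hF.step_cases hd a'.step with hc | ⟨-, hc, hcX, hc'⟩
      · have hc : F.base a'.tail = F.base a'.head := hc
        rw [hc] at haA
        exact absurd haA (hvW hS)
      · have hc : F.base a'.head = a'.head := hc
        have hc' : -a'.headSign = F.out a'.head := hc'
        refine Or.inr ⟨fun h => hvW hS (by rwa [hc]), _, haA, hS, hc, hcX, _, hd, rfl, ?_⟩
        rw [← hc']
        exact a'.step

/-- A path of bases lifts to a connection through the corresponding blossoms. -/
theorem exists_conn_of_iterate (F : B.BlossomForest X) (g : V → V) (x : V) (hx : x ∈ X) (n : ℕ)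
    (hR : ∀ i < n, F.Arc (g^[i] x) (g^[i + 1] x))
    (hinj : ∀ i ≤ n, ∀ j ≤ n, g^[i] x = g^[j] x → i = j) (d : V × ℤˣ) (hd : F.dep d)
    (hb : F.base d.1 = g^[n] x) :
    ∃ s, B.Conn (F.verts {v | ∃ i ≤ n, v = g^[i] x}) (x, s) d := by
  induction n generalizing d with
  | zero =>
    obtain ⟨s, -, h⟩ := inside' hd
    rw [hb] at h
    exact ⟨s, h.mono (F.verts_mono (by rintro v rfl; exact ⟨0, le_rfl, rfl⟩))⟩
  | succ n ih =>
    obtain ⟨h1, h2, h3, p, h4, h5, h6⟩ := hR n (by omega)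
    obtain ⟨s, hs⟩ := ih (fun i hi => hR i (by omega))
      (fun i hi j hj => hinj i (by omega) j (by omega)) p h4 h5
    obtain ⟨t, ht, hc⟩ := inside' hd
    rw [hb] at ht hc
    have : t = F.out (g^[n + 1] x) := (((F.dep_iff _).1 ht).2 h2).resolve_left h3
    rw [this] at hc
    refine ⟨s, (hs.trans h6 hc (F.disjoint_verts ?_)).mono
      (Set.union_subset (F.verts_mono ?_) (F.verts_mono ?_))⟩
    · rw [Set.disjoint_singleton_right]
      rintro ⟨i, hi, h⟩
      have := hinj (n + 1) le_rfl i (by omega) h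
      omega
    · rintro v ⟨i, hi, rfl⟩
      exact ⟨i, by omega, rfl⟩
    · rintro v rfl
      exact ⟨n + 1, le_rfl, rfl⟩

theorem exists_dep (F : B.BlossomForest X) {v : V} (hv : v ∈ F.S) : ∃ s, F.dep (v, s) :=
  ⟨F.out v, (F.dep_iff _).2 ⟨hv, fun _ => Or.inr rfl⟩⟩

/-- If every superset of `Y` has an entrance of size at least `m`, then there are `m` disjoint
`X`–`Y` paths. -/
theorem IsClosed.exists_family [Finite V] {F : B.BlossomForest X} (hF : F.IsClosed) (Y : Set V)
    (m : ℕ) (hm : ∀ W, Y ⊆ W → m ≤ (B.entrance X W).ncard) :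
    ∃ L : Finset B.Trail, B.IsDisjointPathFamily X Y L ∧ L.card = m := by
  classical
  obtain ⟨X', hX'X, hcard, g, n, hT, hR, hinj⟩ :=
    exists_linkage F.Arc X {b | ∃ y ∈ Y, y ∈ F.S ∧ F.base y = b} (fun _ _ h => h.2.2.1) m (by
      intro A hA
      -- This set contains `Y` because `A` avoids the bases of all blossoms that meet `Y`.
      refine (hm {v | v ∈ F.S → F.base v ∉ A} fun y hy hyS hyA => ?_).trans
        (Set.ncard_le_ncard (hF.entrance_subset A))
      exact Set.disjoint_left.1 hA hyA ⟨y, hy, hyS, rfl⟩)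
  have hex : ∀ x, ∃ T : B.Trail, x ∈ X' → T.start = x ∧ T.IsPath ∧
      (∀ v ∈ T.vertices, v ∈ F.verts {v | ∃ i ≤ n x, v = g^[i] x}) ∧
      T.finish ∈ Y ∧ ∀ v ∈ T.vertices, v ∈ Y → v = T.finish := by
    intro x
    by_cases hx : x ∈ X'
    · obtain ⟨y, hy, hyS, hyb⟩ := hT x hx
      obtain ⟨s, hs⟩ := F.exists_dep hyS
      obtain ⟨t, ht⟩ := F.exists_conn_of_iterate g x (hX'X hx) (n x) (hR x hx)
        (fun i hi j hj h => (hinj x hx x hx i hi j hj h).2) _ hs hyb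
      obtain ⟨T, h1, h2, h3, -, -, h4, h5⟩ := ht.exists_trail Y hy
      exact ⟨T, fun _ => ⟨h1, h2, h3, h4, h5⟩⟩
    · exact ⟨⟨x, [], by simp, by simp, by simp⟩, fun h => absurd h hx⟩
  choose P hP using hex
  obtain ⟨X'', hX'', hcard'⟩ := Set.exists_subset_card_eq hcard
  have hfin : X''.Finite := Set.toFinite _
  refine ⟨hfin.toFinset.image P, ⟨?_, ?_⟩, ?_⟩
  · intro Q hQ
    obtain ⟨x, hx, rfl⟩ := Finset.mem_image.1 hQ
    have hx' : x ∈ X' := hX'' (by simpa using hx)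
    obtain ⟨h1, h2, h3, h4, h5⟩ := hP x hx'
    refine ⟨h2, ⟨by rw [h1]; exact hX'X hx', fun v hv hvX => ?_⟩, h4, h5⟩
    rw [h1]
    obtain ⟨-, i, hi, hvi⟩ := h3 v hv
    -- A vertex of `X` is its own base, hence lies on the orbit of bases; after the start, that
    -- orbit consists of heads of arcs, which avoid `X`.
    rw [(F.base_eq_of_mem v hvX).2.1] at hvi
    rcases i with _ | i
    · exact hvi
    · rw [hvi] at hvX
      exact absurd hvX (hR x hx' i (by omega)).2.2.1
  · intro Q hQ Q' hQ' hne
    obtain ⟨x, hx, rfl⟩ := Finset.mem_image.1 hQ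
    obtain ⟨x', hx', rfl⟩ := Finset.mem_image.1 hQ'
    have hx : x ∈ X' := hX'' (by simpa using hx)
    have hx' : x' ∈ X' := hX'' (by simpa using hx')
    intro v hv hv'
    obtain ⟨-, i, hi, h⟩ := (hP x hx).2.2.1 v hv
    obtain ⟨-, j, hj, h'⟩ := (hP x' hx').2.2.1 v hv'
    exact hne (by rw [(hinj x hx x' hx' i hi j hj (h.symm.trans h')).1])
  · rw [Finset.card_image_of_injOn, ← hcard', Set.ncard_eq_toFinset_card _ hfin]
    intro x hx x' hx' h
    rw [← (hP x (hX'' (by simpa using hx))).1, ← (hP x' (hX'' (by simpa using hx'))).1, h]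

end BlossomForest

end BidirectedGraph

theorem mainTheorem9 {V E : Type*} [Finite V] [Finite E] (B : BidirectedGraph V E) (X Y : Set V)
    (hX : ¬ ∃ P : B.Trail, P.IsPath ∧ ¬ P.IsTrivial ∧ P.start ∈ X ∧ P.finish ∈ X) :
    ∃ m : ℕ,
      IsGreatest {n : ℕ | ∃ F : Finset B.Trail, B.IsDisjointPathFamily X Y F ∧ F.card = n} m ∧
      IsLeast {n : ℕ | ∃ W : Set V, Y ⊆ W ∧ (B.entrance X W).ncard = n} m := by
  have hne : {n : ℕ | ∃ W : Set V, Y ⊆ W ∧ (B.entrance X W).ncard = n}.Nonempty :=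
    ⟨_, Y, subset_rfl, rfl⟩
  obtain ⟨W, hW, hWm⟩ := Nat.sInf_mem hne
  obtain ⟨F, hF⟩ := BidirectedGraph.BlossomForest.exists_isClosed
    (BidirectedGraph.Conn.fst_eq_of_mem hX)
  refine ⟨_, ⟨?_, ?_⟩, Nat.sInf_mem hne, fun n hn => Nat.sInf_le hn⟩
  · exact hF.exists_family Y _ fun W hW => Nat.sInf_le ⟨W, hW, rfl⟩
  · rintro _ ⟨L, hL, rfl⟩
    rw [← hWm]
    exact hL.card_le hW
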